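/- Let $\mathcal H$ be a complex Hilbert space with inner product $[\cdot,\cdot]$, linear in the first entry. A linear relation on $\mathcal H$ is a linear subspace $A\subset\mathcal H\times\mathcal H$; its adjoint is $A^*=\{(f,g): [y,f]=[x,g]\ \text{for all }(x,y)\in A\}$; its resolvent set $\varrho(A)$ is the set of $w\in\mathbb C$ for which $(A-w)^{-1}=\{(y-wx,x):(x,y)\in A\}$ is an everywhere defined bounded operator on $\mathcal H$. Let $S$ be a closed symmetric relation ($S\subset S^*$) with deficiency index $(1,1)$, i.e. $\dim\eta_{i}(S)=\dim\eta_{-i}(S)=1$, where $\eta_w(S)=\{y-\overline w x:(x,y)\in S\}^{\perp}$. Let $A=A^*$ be a self-adjoint relation with $S\subset A$, let $\phi\in\eta_i(S)\setminus\{0\}$, and let $v\in\mathcal H$. For $x\in\mathcal H$ and $w\in\varrho(A)$ put $\varphi_x(w)=\bigl(I+(w-i)(A-w)^{-1}\bigr)x$. A function $q:\varrho(A)\to\mathbb C$ is called a $Q$-function associated to $v$ if $$\frac{q(\zeta)-q(\overline w)}{\zeta-\overline w}=[\varphi_v(\zeta),\varphi_\phi(w)]\qquad\text{for all }\zeta,w\in\varrho(A)\text{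 with }\zeta\neq\overline w.$$ **Theorem.** There exist a constant $b\in\mathbb C$ and a finite complex Borel measure $\nu$ on $\mathbb R$ such that, for every $\zeta\in\varrho(A)$, the function $t\mapsto\frac{1+t\zeta}{t-\zeta}$ is $|\nu|$-integrable, and the $Q$-functions associated to $v$ are exactly the functions $$q_c(\zeta)=c+b\,\zeta+\int_{\mathbb R}\frac{1+t\zeta}{t-\zeta}\,\mathrm d\nu(t),\qquad \zeta\in\varrho(A),\quad c\in\mathbb C.$$ The pair $(b,\nu)$ is unique; indeed, if some $Q$-function associated to $v$ equals $c'+b'\zeta+\int_{\mathbb R}\frac{1+t\zeta}{t-\zeta}\,\mathrm d\nu'(t)$ for all $\zeta\in\mathbb C\setminus\mathbb R$, with $c',b'\in\mathbb C$ and a finite complex Borel measure $\nu'$ on $\mathbb R$, then $b'=b$ and $\nu'=\nu$. Moreover, every $Q$-function associated to $v$ is, on $\mathbb C\setminus\mathbb R$, a quasi-Herglotz function: it is analytic there and equals $(h_1-h_2)+i(h_3-h_4)$, where each $h_j:\mathbb C\setminus\mathbb R\to\mathbb C$ is a Herglotz–Nevanlinna function, that is, $h_j$ is analytic, $h_j(\overline\zeta)=\overline{h_j(\zeta)}$,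 and $\operatorname{Im}h_j(\zeta)\ge0$ for $\operatorname{Im}\zeta>0$. -/

import Mathlib

open MeasureTheory
open scoped ComplexConjugate

noncomputable section

/-- A linear relation on `H` is a linear subspace of `H × H`; `(x, y)` belonging to it means that
`y` is one of the values at `x`. -/
abbrev LinRel (H : Type*) [NormedAddCommGroup H] [InnerProductSpace ℂ H] : Type _ :=
  Submodule ℂ (H × H)

namespace LinRel

variable {H : Type*} [NormedAddCommGroup H] [InnerProductSpace ℂ H]

/-- A symmetric relation: closed and contained in its adjoint. Here `Submodule.adjoint` is
`S* = {(f, g) | [y, f] = [x, g] for all (x, y) ∈ S}`. -/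
def IsSymmetricRel (S : LinRel H) : Prop :=
  IsClosed (S : Set (H × H)) ∧ S ≤ S.adjoint

/-- A self-adjoint relation: equal to its adjoint. -/
def IsSelfAdjointRel (A : LinRel H) : Prop :=
  A.adjoint = A

/-- The range `ran (S - w) = {y - w x | (x, y) ∈ S}`. -/
def ranSub (S : LinRel H) (w : ℂ) : Submodule ℂ H :=
  S.map (LinearMap.snd ℂ H H - w • LinearMap.fst ℂ H H)

/-- The defect subspace `η_w(S) = ran (S - conj w)ᗮ`. -/
def defect (S : LinRel H) (w : ℂ) : Submodule ℂ H :=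
  (S.ranSub (conj w))ᗮ

/-- The deficiency index of `S` is `(1, 1)`: `η_i(S)` and `η_{-i}(S)` are one-dimensional. -/
def HasDeficiencyIndexOne (S : LinRel H) : Prop :=
  Module.finrank ℂ (S.defect Complex.I) = 1 ∧ Module.finrank ℂ (S.defect (-Complex.I)) = 1

/-- The relation `(A - w)⁻¹ = {(y - w x, x) | (x, y) ∈ A}`. -/
def invSub (A : LinRel H) (w : ℂ) : LinRel H :=
  A.map ((LinearMap.snd ℂ H H - w • LinearMap.fst ℂ H H).prod (LinearMap.fst ℂ H H))

/-- The resolvent set `ϱ(A)`: those `w` for which `(A - w)⁻¹` is (the graph of) an everywhere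
defined bounded operator. -/
def resolventSet (A : LinRel H) : Set ℂ :=
  {w | ∃ T : H →L[ℂ] H, ∀ x y : H, (x, y) ∈ A.invSub w ↔ T x = y}

open Classical in
/-- The resolvent `(A - w)⁻¹` as a bounded operator, for `w ∈ ϱ(A)` (and `0` otherwise). -/
def resolventOp (A : LinRel H) (w : ℂ) : H →L[ℂ] H :=
  if h : w ∈ A.resolventSet then h.choose else 0

/-- The `φ`-field `φ_v(w) = (I + (w - i) (A - w)⁻¹) v`. -/
def phiField (A : LinRel H) (v : H) (w : ℂ) : H :=
  v + (w - Complex.I) • A.resolventOp w v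

/-- `q` is a `Q`-function associated to `v` (relative to `A` and the defect element `φ`):
`(q(ζ) - q(conj w)) / (ζ - conj w) = [φ_v(ζ), φ_φ(w)]` for `ζ, w ∈ ϱ(A)`, `ζ ≠ conj w`, where
`[x, y]`, linear in `x`, is `inner ℂ y x`. Only the values of `q` on `ϱ(A)` matter. -/
def IsQFunction (A : LinRel H) (φ v : H) (q : ℂ → ℂ) : Prop :=
  ∀ ζ ∈ A.resolventSet, ∀ w ∈ A.resolventSet, ζ ≠ conj w →
    (q ζ - q (conj w)) / (ζ - conj w) = inner ℂ (A.phiField φ w) (A.phiField v ζ)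

end LinRel

/-- Herglotz-Nevanlinna functions on `ℂ ∖ ℝ`. -/
def IsHerglotzNevanlinna (h : ℂ → ℂ) : Prop :=
  AnalyticOnNhd ℂ h {ζ | ζ.im ≠ 0} ∧
  (∀ ζ : ℂ, ζ.im ≠ 0 → h (conj ζ) = conj (h ζ)) ∧
  (∀ ζ : ℂ, 0 < ζ.im → 0 ≤ (h ζ).im)

/-- Quasi-Herglotz functions on `ℂ ∖ ℝ`: `q = (h₁ - h₂) + i (h₃ - h₄)` with
Herglotz-Nevanlinna functions `h₁, h₂, h₃, h₄`. -/
def IsQuasiHerglotz (q : ℂ → ℂ) : Prop :=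
  AnalyticOnNhd ℂ q {ζ | ζ.im ≠ 0} ∧
  ∃ h₁ h₂ h₃ h₄ : ℂ → ℂ,
    IsHerglotzNevanlinna h₁ ∧ IsHerglotzNevanlinna h₂ ∧
    IsHerglotzNevanlinna h₃ ∧ IsHerglotzNevanlinna h₄ ∧
    ∀ ζ : ℂ, ζ.im ≠ 0 → q ζ = (h₁ ζ - h₂ ζ) + Complex.I * (h₃ ζ - h₄ ζ)

/-- The kernel `(1 + t ζ) / (t - ζ)`. -/
def herglotzKernel (ζ : ℂ) (t : ℝ) : ℂ :=
  (1 + (t : ℂ) * ζ) / ((t : ℂ) - ζ)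

/-- `c + b ζ + ∫ (1 + t ζ) / (t - ζ) dν(t)`; the integral against the complex measure `ν` is
the vector-measure integral paired by the multiplication of `ℂ`. -/
def quasiHerglotzFormula (c b : ℂ) (ν : ComplexMeasure ℝ) (ζ : ℂ) : ℂ :=
  c + b * ζ + ν.integral (herglotzKernel ζ) (ContinuousLinearMap.mul ℝ ℂ)

end

/-!
The idea is to replace the self-adjoint relation `A` by the bounded normal operator
`N = (A - i)⁻¹`. Nonreal points lie in the resolvent set (`IsSelfAdjointRel.mem_resolventSet`), and
the resolvent identity for `± i` puts the spectrum of `N` on the circle `s - conj s = 2 i |s|²`,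
which `s = 1 / (t - i)` identifies with `ℝ ∪ {∞}`. For `ζ` in the resolvent set, `φ_x(ζ)` is
`g_ζ(N) x`, where `g_ζ(s) = 1 / (1 - (ζ - i) s)`; in the variable `t` this is `(t - i) / (t - ζ)`.

The Herglotz kernel `(1 + t ζ) / (t - ζ)` becomes a function `k_ζ(s)` that is continuous on the
spectrum, with `k_ζ(0) = ζ` at the point `t = ∞`, and on the circle
`(k_ζ - k_{conj w}) / (ζ - conj w) = conj g_w * g_ζ`. Therefore `ζ ↦ ⟨φ, k_ζ(N) v⟩` is a
`Q`-function (`IsSelfAdjointRel.isQFunction`), and the others differ from it by constants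
(`IsSelfAdjointRel.isQFunction_iff`). By polarization and the Riesz-Markov-Kakutani theorem
(`exists_spectralMeasure`) it is a combination, with coefficients `1, i, -1, -i`, of integrals of
`k_ζ` against positive measures on the spectrum. The masses at `s = 0` give the coefficient `b`, the
rest, moved to the real line, gives `ν`. The four summands are Herglotz-Nevanlinna functions, which
is the quasi-Herglotz decomposition.

For uniqueness (`quasiHerglotzFormula_unique`), write the kernel as `ζ + (1 + ζ²) / (t - ζ)`. If the
formula with constants `c`, `b` and a complex measure `σ` vanishes off the real line, then `b = 0`
and `σ` annihilates `1` and all `1 / (t - ζ)`. The closed span of these functions is a star algebra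
that separates points, hence separates measures.
-/

/-! ### Complex measures as combinations of finite positive measures -/

section ComplexMeasures

variable {X : Type*} [MeasurableSpace X]

/-- The complex measure `∑ k, i ^ k P k` built from four positive measures, that is
`(P 0 - P 2) + i (P 1 - P 3)`. -/
noncomputable def complexOfMeasures (P : Fin 4 → Measure X) [∀ k, IsFiniteMeasure (P k)] :
    ComplexMeasure X :=
  ∑ k : Fin 4, Complex.I ^ (k : ℕ) • (P k).toSignedMeasure.toComplexMeasure 0

theorem smul_toComplexMeasure_apply (P : Measure X) [IsFiniteMeasure P] (z : ℂ) (s : Set X) :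
    (z • P.toSignedMeasure.toComplexMeasure 0 : ComplexMeasure X) s
      = z * (P.toSignedMeasure s : ℂ) := by
  simp only [FunLike.coe_smul, Pi.smul_apply, SignedMeasure.toComplexMeasure_apply, smul_eq_mul]
  congr 1

theorem variation_smul_toComplexMeasure_le (P : Measure X) [IsFiniteMeasure P] (z : ℂ) :
    (z • P.toSignedMeasure.toComplexMeasure 0 : ComplexMeasure X).variation ≤ ‖z‖ₑ • P := by
  refine VectorMeasure.variation_le_of_forall_enorm_le fun s hs => ?_
  rw [smul_toComplexMeasure_apply, enorm_mul, Measure.smul_apply, smul_eq_mul,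
    Measure.toSignedMeasure_apply_measurable hs]
  gcongr
  rw [← ofReal_norm, Complex.norm_real, Real.norm_of_nonneg measureReal_nonneg,
    ofReal_measureReal]

theorem integrable_smul_toComplexMeasure {P : Measure X} [IsFiniteMeasure P] (z : ℂ) {f : X → ℂ}
    (hf : Integrable f P) :
    (z • P.toSignedMeasure.toComplexMeasure 0 : ComplexMeasure X).Integrable f :=
  Integrable.of_measure_le_smul (c := ‖z‖ₑ) (by finiteness)
    (variation_smul_toComplexMeasure_le P z) hf

/-- The pairing for a signed measure, composed with multiplication by `z`, has the same set function
`s ↦ (x ↦ x z P(s))` as the pairing by multiplication for the complex measure `z P`; the two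
integrals are extensions of it with respect to comparable measures. -/
theorem integral_smul_toComplexMeasure {P : Measure X} [IsFiniteMeasure P] (z : ℂ) {f : X → ℂ}
    (hf : Integrable f P) :
    (z • P.toSignedMeasure.toComplexMeasure 0 : ComplexMeasure X).integral f
      (ContinuousLinearMap.mul ℝ ℂ) = z * ∫ x, f x ∂P := by
  set ν : ComplexMeasure X := z • P.toSignedMeasure.toComplexMeasure 0 with hν
  have hfP : Integrable f P.toSignedMeasure.variation := by simpa using hf
  have h1 : z * ∫ x, f x ∂P = _ :=
    (congrArg (ContinuousLinearMap.mul ℝ ℂ z)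
      (VectorMeasure.integral_toSignedMeasure (μ := P) (f := f))).symm
  rw [h1, VectorMeasure.continuousLinearMap_apply_integral hfP]
  have hT : P.toSignedMeasure.transpose
      ((ContinuousLinearMap.compL ℝ ℝ ℂ ℂ (ContinuousLinearMap.mul ℝ ℂ z)) ∘L
        (ContinuousLinearMap.lsmul ℝ ℝ).flip) = ν.transpose (ContinuousLinearMap.mul ℝ ℂ) := by
    ext s hs x
    change z * (P.toSignedMeasure s • x) = x * ν s
    rw [hν, smul_toComplexMeasure_apply, Complex.real_smul]
    ring
  have hdom := dominatedFinMeasAdditive_cbmApplyMeasure ν (ContinuousLinearMap.mul ℝ ℂ)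
  unfold VectorMeasure.integral
  rw [setToFun_congr_measure_of_integrable (μ' := ν.variation) ‖z‖ₑ (by finiteness)
    (by simpa using variation_smul_toComplexMeasure_le P z) _ (C' := ‖ContinuousLinearMap.mul ℝ ℂ‖)
    (by rw [hT]; exact hdom) f hfP]
  exact setToFun_congr_left _ _ (by rw [hT]) f

theorem integrable_complexOfMeasures {P : Fin 4 → Measure X} [∀ k, IsFiniteMeasure (P k)]
    {f : X → ℂ} (hf : ∀ k, Integrable f (P k)) : (complexOfMeasures P).Integrable f :=
  VectorMeasure.Integrable.finsetSum_vectorMeasure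
    fun k _ => integrable_smul_toComplexMeasure _ (hf k)

theorem integral_complexOfMeasures {P : Fin 4 → Measure X} [∀ k, IsFiniteMeasure (P k)]
    {f : X → ℂ} (hf : ∀ k, Integrable f (P k)) :
    (complexOfMeasures P).integral f (ContinuousLinearMap.mul ℝ ℂ)
      = ∑ k : Fin 4, Complex.I ^ (k : ℕ) * ∫ x, f x ∂(P k) := by
  rw [complexOfMeasures, VectorMeasure.integral_finsetSum_vectorMeasure
    fun k _ => integrable_smul_toComplexMeasure _ (hf k)]
  exact Finset.sum_congr rfl fun k _ => integral_smul_toComplexMeasure _ (hf k)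

theorem complexOfMeasures_apply (P : Fin 4 → Measure X) [∀ k, IsFiniteMeasure (P k)] (s : Set X) :
    complexOfMeasures P s
      = ((P 0).toSignedMeasure s - (P 2).toSignedMeasure s : ℝ)
        + Complex.I * ((P 1).toSignedMeasure s - (P 3).toSignedMeasure s : ℝ) := by
  rw [complexOfMeasures, Fin.sum_univ_four]
  simp only [FunLike.coe_add, Pi.add_apply, smul_toComplexMeasure_apply]
  push_cast
  norm_num [pow_succ]
  ring

/-- Jordan decomposition of the real and of the imaginary part. -/
theorem exists_eq_complexOfMeasures (σ : ComplexMeasure X) :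
    ∃ (P : Fin 4 → Measure X) (_ : ∀ k, IsFiniteMeasure (P k)), σ = complexOfMeasures P := by
  set j := (ComplexMeasure.re σ).toJordanDecomposition with hj
  set l := (ComplexMeasure.im σ).toJordanDecomposition with hl
  have hP : ∀ k, IsFiniteMeasure (![j.posPart, l.posPart, j.negPart, l.negPart] k) := by
    intro k
    fin_cases k
    exacts [j.posPart_finite, l.posPart_finite, j.negPart_finite, l.negPart_finite]
  refine ⟨_, hP, ?_⟩
  have h1 : ComplexMeasure.re σ = j.toSignedMeasure := by simp [hj]
  have h2 : ComplexMeasure.im σ = l.toSignedMeasure := by simp [hl]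
  ext s hs
  have e1 : (σ s).re = j.toSignedMeasure s := by rw [← h1]; rfl
  have e2 : (σ s).im = l.toSignedMeasure s := by rw [← h2]; rfl
  rw [← Complex.re_add_im (σ s), e1, e2, complexOfMeasures_apply, mul_comm]
  rfl

end ComplexMeasures

/-! ### Complex measures are determined by their Cauchy transforms -/

section CauchyTransform

open Filter Topology BoundedContinuousFunction

theorem abs_im_le_norm_ofReal_sub (ζ : ℂ) (t : ℝ) : |ζ.im| ≤ ‖(t : ℂ) - ζ‖ := by
  simpa using Complex.abs_im_le_norm ((t : ℂ) - ζ)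

theorem ofReal_sub_ne_zero {ζ : ℂ} (hζ : ζ.im ≠ 0) (t : ℝ) : (t : ℂ) - ζ ≠ 0 := fun h =>
  hζ (by simpa using congrArg Complex.im h)

theorem norm_inv_ofReal_sub_le {ζ : ℂ} (hζ : ζ.im ≠ 0) (t : ℝ) :
    ‖((t : ℂ) - ζ)⁻¹‖ ≤ |ζ.im|⁻¹ := by
  rw [norm_inv]
  exact inv_anti₀ (abs_pos.2 hζ) (abs_im_le_norm_ofReal_sub ζ t)

theorem continuous_inv_ofReal_sub {ζ : ℂ} (hζ : ζ.im ≠ 0) :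
    Continuous fun t : ℝ => ((t : ℂ) - ζ)⁻¹ :=
  Continuous.inv₀ (by fun_prop) (ofReal_sub_ne_zero hζ)

/-- The Cauchy kernel `t ↦ (t - ζ)⁻¹`, for nonreal `ζ`, as a bounded continuous function on `ℝ`. -/
noncomputable def cauchyKernel (ζ : ℂ) (hζ : ζ.im ≠ 0) : ℝ →ᵇ ℂ :=
  ofNormedAddCommGroup (fun t : ℝ => ((t : ℂ) - ζ)⁻¹) (continuous_inv_ofReal_sub hζ) |ζ.im|⁻¹
    (norm_inv_ofReal_sub_le hζ)

@[simp]
theorem cauchyKernel_apply (ζ : ℂ) (hζ : ζ.im ≠ 0) (t : ℝ) :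
    cauchyKernel ζ hζ t = ((t : ℂ) - ζ)⁻¹ := rfl

theorem norm_cauchyKernel_le (ζ : ℂ) (hζ : ζ.im ≠ 0) : ‖cauchyKernel ζ hζ‖ ≤ |ζ.im|⁻¹ :=
  norm_ofNormedAddCommGroup_le _ (by positivity) (norm_inv_ofReal_sub_le hζ)

theorem cauchyKernel_sub (ζ w : ℂ) (hζ : ζ.im ≠ 0) (hw : w.im ≠ 0) :
    cauchyKernel ζ hζ - cauchyKernel w hw
      = (ζ - w) • (cauchyKernel ζ hζ * cauchyKernel w hw) := by
  ext t
  have h1 := ofReal_sub_ne_zero hζ t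
  have h2 := ofReal_sub_ne_zero hw t
  simp only [BoundedContinuousFunction.coe_sub, Pi.sub_apply, cauchyKernel_apply,
    BoundedContinuousFunction.coe_smul, BoundedContinuousFunction.coe_mul, Pi.mul_apply,
    smul_eq_mul]
  field_simp
  ring

/-- The points `(1 + 1 / (n + 1)) ζ` tend to `ζ` without meeting it, and their imaginary parts stay
away from `0`, so that the kernels converge uniformly. -/
theorem exists_tendsto_cauchyKernel (ζ : ℂ) (hζ : ζ.im ≠ 0) :
    ∃ (w : ℕ → ℂ) (hw : ∀ n, (w n).im ≠ 0), Function.Injective w ∧ (∀ n, w n ≠ ζ) ∧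
      Tendsto (fun n => cauchyKernel (w n) (hw n)) atTop (𝓝 (cauchyKernel ζ hζ)) := by
  have him : ∀ n : ℕ, ((1 + ((1 / ((n : ℝ) + 1) : ℝ) : ℂ)) * ζ).im
      = (1 + 1 / ((n : ℝ) + 1)) * ζ.im := by
    intro n
    rw [← Complex.ofReal_one, ← Complex.ofReal_add, Complex.im_ofReal_mul]
  have hpos : ∀ n : ℕ, 0 < 1 / ((n : ℝ) + 1) := fun n => by positivity
  have hne : ∀ n : ℕ, ((1 + ((1 / ((n : ℝ) + 1) : ℝ) : ℂ)) * ζ).im ≠ 0 := by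
    intro n
    rw [him]
    exact mul_ne_zero (by linarith [hpos n]) hζ
  have hζ0 : ζ ≠ 0 := by rintro rfl; simp at hζ
  refine ⟨fun n => (1 + ((1 / ((n : ℝ) + 1) : ℝ) : ℂ)) * ζ, hne, ?_, ?_, ?_⟩
  · intro m n hmn
    have := mul_right_cancel₀ hζ0 hmn
    simpa using this
  · intro n h
    have h2 : (1 + ((1 / ((n : ℝ) + 1) : ℝ) : ℂ)) * ζ = 1 * ζ := by rw [one_mul]; exact h
    have h3 := mul_right_cancel₀ hζ0 h2
    have h4 : ((1 / ((n : ℝ) + 1) : ℝ) : ℂ) = 0 := by linear_combination h3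
    exact (hpos n).ne' (by exact_mod_cast h4)
  · rw [tendsto_iff_norm_sub_tendsto_zero]
    have hlim : Tendsto (fun n : ℕ => 1 / ((n : ℝ) + 1) * (‖ζ‖ * (|ζ.im|⁻¹ * |ζ.im|⁻¹))) atTop
        (𝓝 0) := by
      simpa using tendsto_one_div_add_atTop_nhds_zero_nat.mul_const (‖ζ‖ * (|ζ.im|⁻¹ * |ζ.im|⁻¹))
    refine squeeze_zero (fun n => norm_nonneg _) (fun n => ?_) hlim
    rw [cauchyKernel_sub, norm_smul]
    have e : (1 + ((1 / ((n : ℝ) + 1) : ℝ) : ℂ)) * ζ - ζ = ((1 / ((n : ℝ) + 1) : ℝ) : ℂ) * ζ := by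
      ring
    rw [e, norm_mul, Complex.norm_real, Real.norm_of_nonneg (hpos n).le, mul_assoc]
    refine mul_le_mul_of_nonneg_left (mul_le_mul_of_nonneg_left ?_ (norm_nonneg _)) (hpos n).le
    refine (norm_mul_le _ _).trans (mul_le_mul ?_ (norm_cauchyKernel_le ζ hζ) (norm_nonneg _)
      (by positivity))
    refine (norm_cauchyKernel_le _ _).trans (inv_anti₀ (abs_pos.2 hζ) ?_)
    rw [him, abs_mul, abs_of_pos (show 0 < 1 + 1 / ((n : ℝ) + 1) by linarith [hpos n])]
    nlinarith [hpos n, abs_nonneg ζ.im]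

/-- The constant function `1` together with all Cauchy kernels. -/
def cauchyGenerators : Set (ℝ →ᵇ ℂ) :=
  insert 1 {f | ∃ (ζ : ℂ) (hζ : ζ.im ≠ 0), f = cauchyKernel ζ hζ}

/-- The closed span of `1` and the Cauchy kernels. -/
noncomputable def cauchySpan : Submodule ℂ (ℝ →ᵇ ℂ) :=
  (Submodule.span ℂ cauchyGenerators).topologicalClosure

theorem cauchySpan_le {V : Submodule ℂ (ℝ →ᵇ ℂ)} (hV : IsClosed (V : Set (ℝ →ᵇ ℂ)))
    (h : cauchyGenerators ⊆ V) : cauchySpan ≤ V :=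
  Submodule.topologicalClosure_minimal _ (Submodule.span_le.2 h) hV

theorem isClosed_cauchySpan : IsClosed (cauchySpan : Set (ℝ →ᵇ ℂ)) :=
  Submodule.isClosed_topologicalClosure _

theorem cauchyGenerators_subset : cauchyGenerators ⊆ cauchySpan :=
  Submodule.subset_span.trans (Submodule.le_topologicalClosure _)

theorem cauchyKernel_mem (ζ : ℂ) (hζ : ζ.im ≠ 0) : cauchyKernel ζ hζ ∈ cauchySpan :=
  cauchyGenerators_subset (Or.inr ⟨ζ, hζ, rfl⟩)

theorem one_mem_cauchySpan : (1 : ℝ →ᵇ ℂ) ∈ cauchySpan :=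
  cauchyGenerators_subset (Or.inl rfl)

/-- For distinct poles this is the partial fraction decomposition; the case of a double pole is a
limit of the former. -/
theorem cauchyKernel_mul_mem (ζ w : ℂ) (hζ : ζ.im ≠ 0) (hw : w.im ≠ 0) :
    cauchyKernel ζ hζ * cauchyKernel w hw ∈ cauchySpan := by
  have key : ∀ (ζ w : ℂ) (hζ : ζ.im ≠ 0) (hw : w.im ≠ 0), ζ ≠ w →
      cauchyKernel ζ hζ * cauchyKernel w hw ∈ cauchySpan := by
    intro ζ w hζ hw h
    have e : cauchyKernel ζ hζ * cauchyKernel w hw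
        = (ζ - w)⁻¹ • (cauchyKernel ζ hζ - cauchyKernel w hw) := by
      rw [cauchyKernel_sub, smul_smul, inv_mul_cancel₀ (sub_ne_zero.2 h), one_smul]
    rw [e]
    exact cauchySpan.smul_mem _ (cauchySpan.sub_mem (cauchyKernel_mem _ _) (cauchyKernel_mem _ _))
  by_cases h : ζ = w
  · subst h
    obtain ⟨u, hu, -, hne, hlim⟩ := exists_tendsto_cauchyKernel ζ hζ
    exact isClosed_cauchySpan.mem_of_tendsto (hlim.mul_const (cauchyKernel ζ hζ))
      (Eventually.of_forall fun n => key _ _ _ _ (hne n))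
  · exact key ζ w hζ hw h

theorem mul_mem_cauchySpan {f g : ℝ →ᵇ ℂ} (hf : f ∈ cauchySpan) (hg : g ∈ cauchySpan) :
    f * g ∈ cauchySpan := by
  have step : ∀ a : ℝ →ᵇ ℂ, (∀ b ∈ cauchyGenerators, a * b ∈ cauchySpan) →
      ∀ b ∈ cauchySpan, a * b ∈ cauchySpan := by
    intro a ha
    have hcl : IsClosed ((cauchySpan.comap (LinearMap.mulLeft ℂ a) : Submodule ℂ (ℝ →ᵇ ℂ)) :
        Set (ℝ →ᵇ ℂ)) := isClosed_cauchySpan.preimage (continuous_const_mul a)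
    exact cauchySpan_le hcl ha
  refine step f (fun b hb => ?_) g hg
  rw [mul_comm]
  refine step b (fun a ha => ?_) f hf
  rcases hb with rfl | ⟨w, hw, rfl⟩
  · rw [one_mul]
    exact cauchyGenerators_subset ha
  · rcases ha with rfl | ⟨ζ, hζ, rfl⟩
    · rw [mul_one]
      exact cauchyKernel_mem w hw
    · exact cauchyKernel_mul_mem _ _ _ _

theorem star_mem_cauchySpan {f : ℝ →ᵇ ℂ} (hf : f ∈ cauchySpan) : star f ∈ cauchySpan := by
  have hcl : IsClosed ((cauchySpan.comap
      ((starLinearEquiv ℂ : (ℝ →ᵇ ℂ) ≃ₗ⋆[ℂ] (ℝ →ᵇ ℂ)) : (ℝ →ᵇ ℂ) →ₗ⋆[ℂ] (ℝ →ᵇ ℂ)) :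
      Submodule ℂ (ℝ →ᵇ ℂ)) : Set (ℝ →ᵇ ℂ)) :=
    isClosed_cauchySpan.preimage continuous_star
  refine cauchySpan_le hcl ?_ hf
  rintro f (rfl | ⟨ζ, hζ, rfl⟩)
  · change star (1 : ℝ →ᵇ ℂ) ∈ cauchySpan
    rw [star_one]
    exact one_mem_cauchySpan
  · change star (cauchyKernel ζ hζ) ∈ cauchySpan
    have e : star (cauchyKernel ζ hζ) = cauchyKernel (conj ζ) (by simpa using hζ) := by
      ext t
      simp
    rw [e]
    exact cauchyKernel_mem _ _

/-- The closed span of `1` and the Cauchy kernels as a star subalgebra. -/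
noncomputable def cauchyAlgebra : StarSubalgebra ℂ (ℝ →ᵇ ℂ) where
  carrier := cauchySpan
  mul_mem' := mul_mem_cauchySpan
  add_mem' := cauchySpan.add_mem
  algebraMap_mem' r := by
    rw [Algebra.algebraMap_eq_smul_one]
    exact cauchySpan.smul_mem r one_mem_cauchySpan
  star_mem' := star_mem_cauchySpan

theorem separatesPoints_cauchyAlgebra :
    (cauchyAlgebra.map (toContinuousMapStarₐ ℂ)).SeparatesPoints := by
  intro x y hxy
  have hI : (Complex.I).im ≠ 0 := by simp
  refine ⟨_, ⟨_, ⟨cauchyKernel Complex.I hI, cauchyKernel_mem _ _, rfl⟩, rfl⟩, fun h => hxy ?_⟩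
  have h' : ((x : ℂ) - Complex.I)⁻¹ = ((y : ℂ) - Complex.I)⁻¹ := h
  exact_mod_cast sub_left_injective (inv_injective h')

/-- Integration against a finite measure, on bounded continuous functions. -/
noncomputable def integralBCF (P : Measure ℝ) [IsFiniteMeasure P] : (ℝ →ᵇ ℂ) →L[ℂ] ℂ :=
  LinearMap.mkContinuous
    { toFun f := ∫ t, f t ∂P
      map_add' f g := integral_add (f.integrable P) (g.integrable P)
      map_smul' c _ := integral_const_mul c _ }
    (P.real Set.univ) fun f => f.norm_integral_le_mul_norm P

theorem integralBCF_apply (P : Measure ℝ) [IsFiniteMeasure P] (f : ℝ →ᵇ ℂ) :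
    integralBCF P f = ∫ t, f t ∂P := rfl

theorem integralBCF_star (P : Measure ℝ) [IsFiniteMeasure P] (f : ℝ →ᵇ ℂ) :
    integralBCF P (star f) = conj (integralBCF P f) := by
  rw [integralBCF_apply, integralBCF_apply, ← integral_conj]
  rfl

/-- Integration against the complex measure `complexOfMeasures P`. -/
noncomputable def complexIntegralBCF (P : Fin 4 → Measure ℝ) [∀ k, IsFiniteMeasure (P k)] :
    (ℝ →ᵇ ℂ) →L[ℂ] ℂ :=
  ∑ k : Fin 4, Complex.I ^ (k : ℕ) • integralBCF (P k)

theorem complexIntegralBCF_apply (P : Fin 4 → Measure ℝ) [∀ k, IsFiniteMeasure (P k)]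
    (f : ℝ →ᵇ ℂ) : complexIntegralBCF P f = ∑ k : Fin 4, Complex.I ^ (k : ℕ) * ∫ t, f t ∂(P k) := by
  simp [complexIntegralBCF, integralBCF_apply]

theorem complexIntegralBCF_eq (P : Fin 4 → Measure ℝ) [∀ k, IsFiniteMeasure (P k)]
    (f : ℝ →ᵇ ℂ) : complexIntegralBCF P f = (integralBCF (P 0) f - integralBCF (P 2) f)
      + Complex.I * (integralBCF (P 1) f - integralBCF (P 3) f) := by
  rw [complexIntegralBCF_apply, Fin.sum_univ_four]
  norm_num [pow_succ, integralBCF_apply]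
  ring

/-- The algebra `cauchyAlgebra` is closed under `star`, so a complex measure that annihilates it has
a real and an imaginary part that do, and signed measures are separated by it. -/
theorem complexOfMeasures_eq_zero {P : Fin 4 → Measure ℝ} [∀ k, IsFiniteMeasure (P k)]
    (h : ∀ f ∈ cauchyGenerators, complexIntegralBCF P f = 0) : complexOfMeasures P = 0 := by
  have hW : ∀ f ∈ cauchySpan, complexIntegralBCF P f = 0 := by
    have : cauchySpan ≤ (complexIntegralBCF P).ker :=
      cauchySpan_le (complexIntegralBCF P).isClosed_ker h
    exact this
  have hsplit : ∀ f ∈ cauchySpan, integralBCF (P 0) f = integralBCF (P 2) f ∧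
      integralBCF (P 1) f = integralBCF (P 3) f := by
    intro f hf
    have h1 := hW f hf
    have h2 := congrArg conj (hW _ (star_mem_cauchySpan hf))
    rw [complexIntegralBCF_eq] at h1 h2
    simp only [integralBCF_star, map_add, map_sub, map_mul, Complex.conj_conj, Complex.conj_I,
      map_zero] at h2
    refine ⟨by linear_combination (h1 + h2) / 2, ?_⟩
    have h3 : Complex.I * (integralBCF (P 1) f - integralBCF (P 3) f) = 0 := by
      linear_combination (h1 - h2) / 2
    simpa [sub_eq_zero] using h3
  have e02 : P 0 = P 2 := ext_of_forall_mem_subalgebra_integral_eq_of_polish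
    separatesPoints_cauchyAlgebra fun g hg => (hsplit g hg).1
  have e13 : P 1 = P 3 := ext_of_forall_mem_subalgebra_integral_eq_of_polish
    separatesPoints_cauchyAlgebra fun g hg => (hsplit g hg).2
  ext s hs
  rw [complexOfMeasures_apply]
  simp [hs, e02, e13]

theorem herglotzKernel_eq (ζ : ℂ) (hζ : ζ.im ≠ 0) :
    herglotzKernel ζ = ⇑(ζ • (1 : ℝ →ᵇ ℂ) + (1 + ζ ^ 2) • cauchyKernel ζ hζ) := by
  ext t
  have h1 := ofReal_sub_ne_zero hζ t
  simp only [herglotzKernel, BoundedContinuousFunction.coe_add, Pi.add_apply,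
    BoundedContinuousFunction.coe_smul, cauchyKernel_apply, smul_eq_mul,
    BoundedContinuousFunction.coe_one, Pi.one_apply]
  field_simp
  ring

theorem integrable_herglotzKernel (P : Measure ℝ) [IsFiniteMeasure P] {ζ : ℂ} (hζ : ζ.im ≠ 0) :
    Integrable (herglotzKernel ζ) P := by
  rw [herglotzKernel_eq ζ hζ]
  exact BoundedContinuousFunction.integrable P _

theorem quasiHerglotzFormula_complexOfMeasures (c b : ℂ) (P : Fin 4 → Measure ℝ)
    [∀ k, IsFiniteMeasure (P k)] (ζ : ℂ) (hζ : ζ.im ≠ 0) :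
    quasiHerglotzFormula c b (complexOfMeasures P) ζ
      = c + b * ζ + (ζ * complexIntegralBCF P 1
        + (1 + ζ ^ 2) * complexIntegralBCF P (cauchyKernel ζ hζ)) := by
  rw [quasiHerglotzFormula, integral_complexOfMeasures fun k => integrable_herglotzKernel (P k) hζ,
    herglotzKernel_eq ζ hζ, ← complexIntegralBCF_apply, map_add, map_smul, map_smul, smul_eq_mul,
    smul_eq_mul]

/-- Along the imaginary axis `-ζ (t - ζ)⁻¹` tends to `1` boundedly. -/
theorem tendsto_integral_cauchyKernel (P : Measure ℝ) [IsFiniteMeasure P] :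
    Tendsto (fun n : ℕ => ∫ t : ℝ, -(((n : ℝ) + 1 : ℝ) * Complex.I)
      * ((t : ℂ) - ((n : ℝ) + 1 : ℝ) * Complex.I)⁻¹ ∂P) atTop (𝓝 (∫ _ : ℝ, (1 : ℂ) ∂P)) := by
  have him : ∀ n : ℕ, ((((n : ℝ) + 1 : ℝ) : ℂ) * Complex.I).im = (n : ℝ) + 1 := fun n => by simp
  have hpos : ∀ n : ℕ, (0 : ℝ) < (n : ℝ) + 1 := fun n => by positivity
  have hne : ∀ n : ℕ, ((((n : ℝ) + 1 : ℝ) : ℂ) * Complex.I).im ≠ 0 := fun n => by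
    rw [him]; exact (hpos n).ne'
  refine tendsto_integral_of_dominated_convergence (fun _ => 1) (fun n => ?_) (integrable_const _)
    (fun n => Eventually.of_forall fun t => ?_) (Eventually.of_forall fun t => ?_)
  · exact ((continuous_inv_ofReal_sub (hne n)).const_mul _).aestronglyMeasurable
  · rw [norm_mul, norm_neg, norm_mul, Complex.norm_I, mul_one, Complex.norm_real,
      Real.norm_of_nonneg (hpos n).le]
    have := norm_inv_ofReal_sub_le (hne n) t
    rw [him, abs_of_pos (hpos n)] at this
    calc _ ≤ ((n : ℝ) + 1) * ((n : ℝ) + 1)⁻¹ := mul_le_mul_of_nonneg_left this (hpos n).le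
      _ = 1 := mul_inv_cancel₀ (hpos n).ne'
  · rw [tendsto_iff_norm_sub_tendsto_zero]
    have hlim : Tendsto (fun n : ℕ => |t| * (1 / ((n : ℝ) + 1))) atTop (𝓝 0) := by
      simpa using tendsto_one_div_add_atTop_nhds_zero_nat.const_mul |t|
    refine squeeze_zero (fun n => norm_nonneg _) (fun n => ?_) hlim
    have h0 := ofReal_sub_ne_zero (hne n) t
    have e : -((((n : ℝ) + 1 : ℝ) : ℂ) * Complex.I)
        * ((t : ℂ) - (((n : ℝ) + 1 : ℝ) : ℂ) * Complex.I)⁻¹ - 1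
        = -(t : ℂ) * ((t : ℂ) - (((n : ℝ) + 1 : ℝ) : ℂ) * Complex.I)⁻¹ := by
      field_simp
      ring
    have := norm_inv_ofReal_sub_le (hne n) t
    rw [him, abs_of_pos (hpos n)] at this
    rw [e, norm_mul, norm_neg, Complex.norm_real, Real.norm_eq_abs, one_div]
    exact mul_le_mul_of_nonneg_left this (abs_nonneg t)

/-- If the formula vanishes off the real line, then the values at `± i` give `c = 0` and
`b = -σ(ℝ)`, hence the Cauchy transform of `σ` vanishes; its behaviour along the imaginary axis
gives `σ(ℝ) = 0`. -/
theorem eq_zero_of_quasiHerglotzFormula_eq_zero {c b : ℂ} {σ : ComplexMeasure ℝ}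
    (h : ∀ ζ : ℂ, ζ.im ≠ 0 → quasiHerglotzFormula c b σ ζ = 0) : b = 0 ∧ σ = 0 := by
  obtain ⟨P, hP, rfl⟩ := exists_eq_complexOfMeasures σ
  have h' : ∀ (ζ : ℂ) (hζ : ζ.im ≠ 0), c + b * ζ + (ζ * complexIntegralBCF P 1
        + (1 + ζ ^ 2) * complexIntegralBCF P (cauchyKernel ζ hζ)) = 0 := fun ζ hζ => by
    rw [← quasiHerglotzFormula_complexOfMeasures]
    exact h ζ hζ
  have hI := h' Complex.I (by simp)
  have hI' := h' (-Complex.I) (by simp)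
  have hc : c = 0 := by
    simp only [neg_sq, Complex.I_sq, add_neg_cancel, zero_mul, add_zero] at hI hI'
    linear_combination (hI + hI') / 2
  have hb : b + complexIntegralBCF P 1 = 0 := by
    simp only [Complex.I_sq, add_neg_cancel, zero_mul, add_zero, hc] at hI
    have : Complex.I * (b + complexIntegralBCF P 1) = 0 := by linear_combination hI
    simpa using this
  have hker' : ∀ (ζ : ℂ) (hζ : ζ.im ≠ 0), ζ ∉ ({Complex.I, -Complex.I} : Set ℂ) →
      complexIntegralBCF P (cauchyKernel ζ hζ) = 0 := by
    intro ζ hζ hne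
    have h1 : (1 + ζ ^ 2) * complexIntegralBCF P (cauchyKernel ζ hζ) = 0 := by
      linear_combination h' ζ hζ - ζ * hb - hc
    refine (mul_eq_zero.1 h1).resolve_left fun h2 => hne ?_
    have h3 : (ζ - Complex.I) * (ζ + Complex.I) = 0 := by
      linear_combination h2 - Complex.I_sq
    rcases mul_eq_zero.1 h3 with h4 | h4
    · exact Or.inl (sub_eq_zero.1 h4)
    · exact Or.inr (eq_neg_of_add_eq_zero_left h4)
  have hker : ∀ (ζ : ℂ) (hζ : ζ.im ≠ 0), complexIntegralBCF P (cauchyKernel ζ hζ) = 0 := by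
    intro ζ hζ
    obtain ⟨w, hw, hinj, -, hlim⟩ := exists_tendsto_cauchyKernel ζ hζ
    have hev : ∀ᶠ n in atTop, w n ∉ ({Complex.I, -Complex.I} : Set ℂ) := by
      rw [← Nat.cofinite_eq_atTop]
      exact hinj.tendsto_cofinite.eventually (Set.toFinite _).compl_mem_cofinite
    refine tendsto_nhds_unique (((complexIntegralBCF P).continuous.tendsto _).comp hlim) ?_
    refine tendsto_const_nhds.congr' ?_
    filter_upwards [hev] with n hn
    exact (hker' _ _ hn).symm
  have hone : complexIntegralBCF P 1 = 0 := by
    have hlim : Tendsto (fun n : ℕ => ∑ k : Fin 4, Complex.I ^ (k : ℕ) *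
        ∫ t : ℝ, -(((n : ℝ) + 1 : ℝ) * Complex.I)
          * ((t : ℂ) - ((n : ℝ) + 1 : ℝ) * Complex.I)⁻¹ ∂(P k)) atTop
        (𝓝 (complexIntegralBCF P 1)) := by
      rw [complexIntegralBCF_apply]
      exact tendsto_finsetSum _ fun k _ => (tendsto_integral_cauchyKernel (P k)).const_mul _
    refine tendsto_nhds_unique hlim (tendsto_const_nhds.congr fun n => ?_)
    have hne : ((((n : ℝ) + 1 : ℝ) : ℂ) * Complex.I).im ≠ 0 := by
      simp only [Complex.mul_I_im, Complex.ofReal_re]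
      positivity
    have := congrArg (fun z => -((((n : ℝ) + 1 : ℝ) : ℂ) * Complex.I) * z) (hker _ hne)
    simp only [complexIntegralBCF_apply, cauchyKernel_apply, mul_zero, Finset.mul_sum] at this
    rw [← this]
    refine Finset.sum_congr rfl fun k _ => ?_
    rw [integral_const_mul]
    ring
  refine ⟨by simpa [hone] using hb, complexOfMeasures_eq_zero ?_⟩
  rintro f (rfl | ⟨ζ, hζ, rfl⟩)
  exacts [hone, hker ζ hζ]

/-- Every complex measure has the form `complexOfMeasures P`, so nonreal kernels are integrable. -/
theorem complexMeasure_integrable_herglotzKernel (σ : ComplexMeasure ℝ) {ζ : ℂ} (hζ : ζ.im ≠ 0) :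
    σ.Integrable (herglotzKernel ζ) := by
  obtain ⟨P, hP, rfl⟩ := exists_eq_complexOfMeasures σ
  exact integrable_complexOfMeasures fun k => integrable_herglotzKernel (P k) hζ

theorem quasiHerglotzFormula_unique {c b c' b' : ℂ} {ν ν' : ComplexMeasure ℝ}
    (h : ∀ ζ : ℂ, ζ.im ≠ 0 → quasiHerglotzFormula c b ν ζ = quasiHerglotzFormula c' b' ν' ζ) :
    b = b' ∧ ν = ν' := by
  have := eq_zero_of_quasiHerglotzFormula_eq_zero (c := c - c') (b := b - b') (σ := ν - ν')
    fun ζ hζ => by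
      have h1 := h ζ hζ
      unfold quasiHerglotzFormula at h1 ⊢
      rw [VectorMeasure.integral_sub_vectorMeasure (complexMeasure_integrable_herglotzKernel ν hζ)
        (complexMeasure_integrable_herglotzKernel ν' hζ)]
      linear_combination h1
  exact ⟨sub_eq_zero.1 this.1, sub_eq_zero.1 this.2⟩

end CauchyTransform

/-! ### Resolvents of self-adjoint relations -/

namespace LinRel

section Resolvent

variable {H : Type*} [NormedAddCommGroup H] [InnerProductSpace ℂ H]

theorem mem_invSub {A : LinRel H} {w : ℂ} {x y : H} :
    (x, y) ∈ A.invSub w ↔ (y, x + w • y) ∈ A := by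
  constructor
  · rintro ⟨⟨a, b⟩, hab, h⟩
    have h1 : b - w • a = x := congrArg Prod.fst h
    have h2 : a = y := congrArg Prod.snd h
    subst h1 h2
    simpa using hab
  · intro h
    exact ⟨_, h, Prod.ext (add_sub_cancel_right x (w • y)) rfl⟩

theorem mem_iff_resolventOp {A : LinRel H} {w : ℂ} (hw : w ∈ A.resolventSet) {x y : H} :
    (y, x + w • y) ∈ A ↔ A.resolventOp w x = y := by
  rw [← mem_invSub, resolventOp, dif_pos hw]
  exact hw.choose_spec x y

theorem resolventOp_mem {A : LinRel H} {w : ℂ} (hw : w ∈ A.resolventSet) (x : H) :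
    (A.resolventOp w x, x + w • A.resolventOp w x) ∈ A :=
  (mem_iff_resolventOp hw).2 rfl

theorem resolventOp_eq {A : LinRel H} {w : ℂ} {T : H →L[ℂ] H}
    (h : ∀ x y : H, (y, x + w • y) ∈ A ↔ T x = y) :
    w ∈ A.resolventSet ∧ A.resolventOp w = T := by
  have hw : w ∈ A.resolventSet := ⟨T, fun x y => by rw [mem_invSub, h]⟩
  refine ⟨hw, ?_⟩
  ext x
  exact (mem_iff_resolventOp hw).1 ((h x _).2 rfl)

/-- The first resolvent identity. -/
theorem resolventOp_sub {A : LinRel H} {ζ w : ℂ} (hζ : ζ ∈ A.resolventSet)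
    (hw : w ∈ A.resolventSet) :
    A.resolventOp ζ - A.resolventOp w = (ζ - w) • (A.resolventOp ζ * A.resolventOp w) := by
  ext x
  have h := resolventOp_mem hw x
  have e : x + w • A.resolventOp w x
      = (x - (ζ - w) • A.resolventOp w x) + ζ • A.resolventOp w x := by module
  rw [e, mem_iff_resolventOp hζ, map_sub, map_smul] at h
  change A.resolventOp ζ x - A.resolventOp w x
    = (ζ - w) • A.resolventOp ζ (A.resolventOp w x)
  rw [sub_eq_iff_eq_add] at h ⊢
  rw [h, add_comm]

theorem resolventOp_commute {A : LinRel H} {ζ w : ℂ} (hζ : ζ ∈ A.resolventSet)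
    (hw : w ∈ A.resolventSet) :
    Commute (A.resolventOp ζ) (A.resolventOp w) := by
  by_cases h : ζ = w
  · subst h
    exact Commute.refl _
  · have h1 := resolventOp_sub hζ hw
    have h2 := resolventOp_sub hw hζ
    have h3 : (ζ - w) • (A.resolventOp ζ * A.resolventOp w)
        = (ζ - w) • (A.resolventOp w * A.resolventOp ζ) := by
      rw [← h1, ← neg_sub w ζ, neg_smul, ← h2, neg_sub]
    exact smul_right_injective _ (sub_ne_zero.2 h) h3

theorem IsSelfAdjointRel.mem_iff {A : LinRel H} (hA : A.IsSelfAdjointRel) {x y : H} :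
    (x, y) ∈ A ↔ ∀ a b, (a, b) ∈ A → inner ℂ b x = inner ℂ a y := by
  conv_lhs => rw [← hA]
  simp [sub_eq_zero]

/-- `(A - conj w)⁻¹` is the Hilbert space adjoint of `(A - w)⁻¹`. -/
theorem IsSelfAdjointRel.resolventOp_conj [CompleteSpace H] {A : LinRel H}
    (hA : A.IsSelfAdjointRel) {w : ℂ} (hw : w ∈ A.resolventSet) :
    conj w ∈ A.resolventSet ∧ A.resolventOp (conj w) = star (A.resolventOp w) := by
  refine resolventOp_eq fun x y => ⟨fun h => ?_, ?_⟩
  · refine ext_inner_left ℂ fun z => ?_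
    rw [ContinuousLinearMap.star_eq_adjoint, ContinuousLinearMap.adjoint_inner_right]
    have := hA.mem_iff.1 h _ _ (resolventOp_mem hw z)
    rw [inner_add_left, inner_add_right, inner_smul_left, inner_smul_right] at this
    exact (add_right_cancel this).symm
  · rintro rfl
    refine hA.mem_iff.2 fun a b hab => ?_
    have h1 : A.resolventOp w (b - w • a) = a :=
      (mem_iff_resolventOp hw).1 (by simpa using hab)
    have h2 : inner ℂ (A.resolventOp w (b - w • a)) x
        = inner ℂ (b - w • a) (star (A.resolventOp w) x) := by
      rw [ContinuousLinearMap.star_eq_adjoint, ContinuousLinearMap.adjoint_inner_right]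
    rw [h1, inner_sub_left, inner_smul_left] at h2
    rw [inner_add_right, inner_smul_right, h2]
    ring

/-- The form `⟨x, y⟩` is real on a self-adjoint relation, so only `-w x` contributes to the
imaginary part of `⟨x, y - w x⟩`. -/
theorem IsSelfAdjointRel.norm_le {A : LinRel H} (hA : A.IsSelfAdjointRel) (w : ℂ) {x y : H}
    (h : (x, y) ∈ A) : |w.im| * ‖x‖ ≤ ‖y - w • x‖ := by
  have hreal : (inner ℂ x y).im = 0 := by
    have h1 := hA.mem_iff.1 h x y h
    have h2 := congrArg Complex.im (inner_conj_symm x y)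
    rw [h1, Complex.conj_im] at h2
    linarith
  have him : (inner ℂ x (y - w • x)).im = -(w.im * ‖x‖ ^ 2) := by
    rw [inner_sub_right, inner_smul_right, inner_self_eq_norm_sq_to_K, Complex.sub_im, hreal]
    have : ((‖x‖ : ℂ) ^ 2) = ((‖x‖ ^ 2 : ℝ) : ℂ) := by push_cast; rfl
    rw [show ((RCLike.ofReal ‖x‖ : ℂ)) = (‖x‖ : ℂ) from rfl, this, Complex.im_mul_ofReal]
    ring
  rcases (norm_nonneg x).eq_or_lt with h0 | h0
  · rw [← h0, mul_zero]
    exact norm_nonneg _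
  · have h1 : |(inner ℂ x (y - w • x)).im| ≤ ‖x‖ * ‖y - w • x‖ :=
      (Complex.abs_im_le_norm _).trans (norm_inner_le_norm _ _)
    rw [him, abs_neg, abs_mul, abs_of_nonneg (sq_nonneg ‖x‖)] at h1
    refine le_of_mul_le_mul_left ?_ h0
    linarith

theorem IsSelfAdjointRel.isClosed {A : LinRel H} (hA : A.IsSelfAdjointRel) :
    IsClosed (A : Set (H × H)) := by
  have : (A : Set (H × H)) = ⋂ p : A, {q : H × H | inner ℂ p.1.2 q.1 = inner ℂ p.1.1 q.2} := by
    ext ⟨x, y⟩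
    rw [SetLike.mem_coe, hA.mem_iff, Set.mem_iInter]
    exact ⟨fun h p => h _ _ p.2, fun h a b hab => h ⟨(a, b), hab⟩⟩
  rw [this]
  exact isClosed_iInter fun p => isClosed_eq (by fun_prop) (by fun_prop)

/-- For nonreal `w` the map `(x, y) ↦ y - w x` is bounded below on `A`, so its range is closed; the
range is dense because its orthogonal complement is the kernel of `A - conj w`. -/
theorem IsSelfAdjointRel.mem_resolventSet [CompleteSpace H] {A : LinRel H}
    (hA : A.IsSelfAdjointRel) {w : ℂ} (hw : w.im ≠ 0) : w ∈ A.resolventSet := by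
  have : CompleteSpace A := hA.isClosed.completeSpace_coe
  let D : A →L[ℂ] H :=
    (ContinuousLinearMap.snd ℂ H H - w • ContinuousLinearMap.fst ℂ H H) ∘L A.subtypeL
  have hD : ∀ p : A, D p = p.1.2 - w • p.1.1 := fun p => rfl
  have hpos : 0 < |w.im| := abs_pos.2 hw
  have hbound : ∀ p : A, ‖p.1.1‖ ≤ |w.im|⁻¹ * ‖D p‖ := fun p => by
    have h1 := hA.norm_le w (x := p.1.1) (y := p.1.2) p.2
    rw [hD, inv_mul_eq_div, le_div_iff₀ hpos]
    linarith
  have hanti : AntilipschitzWith (Real.toNNReal (1 + (1 + ‖w‖) * |w.im|⁻¹)) D := by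
    refine AddMonoidHomClass.antilipschitz_of_bound D fun p => ?_
    rw [Real.coe_toNNReal _ (by positivity)]
    have h1 := hbound p
    have h2 : ‖p.1.2‖ ≤ ‖D p‖ + ‖w‖ * ‖p.1.1‖ := by
      have e : p.1.2 = D p + w • p.1.1 := by rw [hD]; abel
      calc ‖p.1.2‖ = ‖D p + w • p.1.1‖ := by rw [← e]
        _ ≤ ‖D p‖ + ‖w • p.1.1‖ := norm_add_le _ _
        _ = _ := by rw [norm_smul]
    have h3 : ‖w‖ * ‖p.1.1‖ ≤ ‖w‖ * (|w.im|⁻¹ * ‖D p‖) :=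
      mul_le_mul_of_nonneg_left h1 (norm_nonneg w)
    have h4 : 0 ≤ ‖w‖ * (|w.im|⁻¹ * ‖D p‖) := by positivity
    have h5 : 0 ≤ |w.im|⁻¹ * ‖D p‖ := by positivity
    have h6 := norm_nonneg (D p)
    change max ‖p.1.1‖ ‖p.1.2‖ ≤ _
    refine max_le ?_ ?_ <;> nlinarith
  have hclosed : IsClosed (D.range : Set H) :=
    hanti.isClosed_range D.uniformContinuous
  have hrange : D.range = ⊤ := by
    have : CompleteSpace D.range := hclosed.completeSpace_coe
    rw [← Submodule.orthogonal_eq_bot_iff, Submodule.eq_bot_iff]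
    intro z hz
    have hzA : (z, conj w • z) ∈ A := hA.mem_iff.2 fun a b hab => by
      have h1 := (Submodule.mem_orthogonal _ _).1 hz (D ⟨(a, b), hab⟩) ⟨_, rfl⟩
      rw [hD, inner_sub_left, inner_smul_left, sub_eq_zero] at h1
      rw [inner_smul_right]
      exact h1
    have h2 := hA.norm_le (conj w) hzA
    rw [sub_self, norm_zero, Complex.conj_im, abs_neg] at h2
    exact norm_le_zero_iff.1 (nonpos_of_mul_nonpos_right h2 hpos)
  let e := ContinuousLinearEquiv.ofBijective D (LinearMap.ker_eq_bot.2 hanti.injective) hrange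
  have he : ∀ p : A, e p = p.1.2 - w • p.1.1 := fun p => rfl
  refine (resolventOp_eq
    (T := (ContinuousLinearMap.fst ℂ H H) ∘L A.subtypeL ∘L (e.symm : H →L[ℂ] A))
    fun x y => ⟨fun h => ?_, fun h => ?_⟩).1
  · have : e ⟨_, h⟩ = x := by rw [he]; simp
    change (e.symm x).1.1 = y
    rw [← this, e.symm_apply_apply]
  · change (e.symm x).1.1 = y at h
    have h1 := he (e.symm x)
    rw [e.apply_symm_apply, h] at h1
    have h2 : ((e.symm x).1.1, (e.symm x).1.2) ∈ A := (e.symm x).2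
    rw [h] at h2
    rwa [h1, sub_add_cancel]

end Resolvent

end LinRel

/-! ### Spectral measures of normal operators -/

section SpectralMeasure

variable {H : Type*} [NormedAddCommGroup H] [InnerProductSpace ℂ H] [CompleteSpace H]

/-- A real continuous function on `K`, regarded as a complex-valued one. -/
noncomputable def complexify {K : Set ℂ} (f : C(K, ℝ)) : C(K, ℂ) :=
  ⟨fun s => (f s : ℂ), by fun_prop⟩

/-- A function `f ≥ 0` is the square of `√f`, so `⟨x, f(N) x⟩ = ‖√f(N) x‖²`. -/
theorem re_inner_cfcHom_nonneg {N : H →L[ℂ] H} (hN : IsStarNormal N) (x : H)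
    {f : C(spectrum ℂ N, ℝ)} (hf : 0 ≤ f) :
    0 ≤ (inner ℂ x (cfcHom hN (complexify f) x)).re := by
  let g : C(spectrum ℂ N, ℝ) := ⟨fun s => Real.sqrt (f s), by fun_prop⟩
  have hg : complexify f = star (complexify g) * complexify g := by
    ext s
    change (f s : ℂ) = conj (g s : ℂ) * (g s : ℂ)
    rw [Complex.conj_ofReal, ← Complex.ofReal_mul]
    exact congrArg _ (Real.mul_self_sqrt (hf s)).symm
  rw [hg, map_mul, map_star, ContinuousLinearMap.star_eq_adjoint]
  rw [mul_apply_eq_comp, ContinuousLinearMap.adjoint_inner_right]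
  exact inner_self_nonneg (𝕜 := ℂ)

/-- The positive functional `f ↦ ⟨x, f(N) x⟩` on real continuous functions on the spectrum. -/
noncomputable def spectralFunctional {N : H →L[ℂ] H} (hN : IsStarNormal N) (x : H) :
    CompactlySupportedContinuousMap (spectrum ℂ N) ℝ →ₚ[ℝ] ℝ :=
  PositiveLinearMap.mk₀
    { toFun f := (inner ℂ x (cfcHom hN (complexify f.toContinuousMap) x)).re
      map_add' f g := by
        have : complexify (f + g).toContinuousMap
            = complexify f.toContinuousMap + complexify g.toContinuousMap := by
          ext s
          exact Complex.ofReal_add _ _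
        rw [this, map_add, add_apply, inner_add_right, Complex.add_re]
      map_smul' c f := by
        have : complexify (c • f).toContinuousMap
            = (c : ℂ) • complexify f.toContinuousMap := by
          ext s
          exact Complex.ofReal_mul _ _
        rw [this, map_smul, smul_apply, inner_smul_right,
          Complex.re_ofReal_mul]
        rfl }
    fun f hf => re_inner_cfcHom_nonneg hN x hf

theorem inner_cfcHom_complexify {N : H →L[ℂ] H} (hN : IsStarNormal N) (x : H)
    (f : C(spectrum ℂ N, ℝ)) :
    inner ℂ x (cfcHom hN (complexify f) x)
      = ((inner ℂ x (cfcHom hN (complexify f) x)).re : ℂ) := by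
  have hsa : star (cfcHom hN (complexify f)) = cfcHom hN (complexify f) := by
    rw [← map_star]
    congr 1
    ext s
    exact Complex.conj_ofReal _
  refine (Complex.conj_eq_iff_re.1 ?_).symm
  rw [inner_conj_symm]
  conv_rhs => rw [← hsa]
  rw [ContinuousLinearMap.star_eq_adjoint, ContinuousLinearMap.adjoint_inner_right]

/-- The scalar spectral measures of a normal operator, obtained from the continuous functional
calculus by the Riesz-Markov-Kakutani theorem. -/
theorem exists_spectralMeasure {N : H →L[ℂ] H} (hN : IsStarNormal N) (x : H) :
    ∃ μ : Measure ℂ, IsFiniteMeasure μ ∧ (∀ᵐ s ∂μ, s ∈ spectrum ℂ N) ∧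
      ∀ f : ℂ → ℂ, ContinuousOn f (spectrum ℂ N) → Integrable f μ ∧
        inner ℂ x (cfc f N x) = ∫ s, f s ∂μ := by
  have hK : IsCompact (spectrum ℂ N) := spectrum.isCompact N
  have hKc : CompactSpace (spectrum ℂ N) := isCompact_iff_compactSpace.1 hK
  let m : Measure (spectrum ℂ N) := RealRMK.rieszMeasure (spectralFunctional hN x)
  have hreal : ∀ f : C(spectrum ℂ N, ℝ),
      inner ℂ x (cfcHom hN (complexify f) x) = ∫ s, (f s : ℂ) ∂m := by
    intro f
    let f' : CompactlySupportedContinuousMap (spectrum ℂ N) ℝ :=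
      { toFun := f
        hasCompactSupport' := HasCompactSupport.of_compactSpace _ }
    have h1 : ∫ s, f s ∂m = (inner ℂ x (cfcHom hN (complexify f) x)).re :=
      RealRMK.integral_rieszMeasure (spectralFunctional hN x) f'
    rw [inner_cfcHom_complexify, ← h1]
    exact integral_ofReal.symm
  have hcont : ∀ f : C(spectrum ℂ N, ℂ), Integrable f m := fun f =>
    f.continuous.integrable_of_hasCompactSupport (HasCompactSupport.of_compactSpace _)
  have hcomplex : ∀ f : C(spectrum ℂ N, ℂ), inner ℂ x (cfcHom hN f x) = ∫ s, f s ∂m := by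
    intro f
    let u : C(spectrum ℂ N, ℝ) := ⟨fun s => (f s).re, by fun_prop⟩
    let v : C(spectrum ℂ N, ℝ) := ⟨fun s => (f s).im, by fun_prop⟩
    have hf : f = complexify u + Complex.I • complexify v := by
      ext s
      change f s = ((f s).re : ℂ) + Complex.I * ((f s).im : ℂ)
      rw [mul_comm, Complex.re_add_im]
    have e : ∀ s, f s = (u s : ℂ) + Complex.I * (v s : ℂ) := fun s => DFunLike.congr_fun hf s
    rw [hf, map_add, map_smul, add_apply, smul_apply,
      inner_add_right, inner_smul_right, hreal, hreal, ← hf, integral_congr_ae (ae_of_all _ e),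
      ← integral_const_mul]
    exact (integral_add (hcont (complexify u)) ((hcont (complexify v)).const_mul _)).symm
  have hemb : MeasurableEmbedding (Subtype.val : spectrum ℂ N → ℂ) :=
    MeasurableEmbedding.subtype_coe hK.measurableSet
  refine ⟨m.map Subtype.val, Measure.isFiniteMeasure_map _ _, ?_, fun f hf => ⟨?_, ?_⟩⟩
  · rw [hemb.ae_map_iff]
    exact ae_of_all _ fun s => s.2
  · rw [hemb.integrable_map_iff]
    exact hcont ⟨_, hf.domRestrict⟩
  · rw [hemb.integral_map, cfc_apply f N hN hf]
    exact hcomplex ⟨_, hf.domRestrict⟩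

end SpectralMeasure

/-! ### Functional calculus of a self-adjoint relation -/

/-- The function `1 / (1 - (ζ - i) s)`; under `s = 1 / (t - i)` it is `(t - i) / (t - ζ)`. -/
noncomputable def phiSymbol (ζ s : ℂ) : ℂ := (1 - (ζ - Complex.I) * s)⁻¹

/-- The kernel `(1 + t ζ) / (t - ζ)` in the variable `s = 1 / (t - i)`. At `s = 0`, which stands
for `t = ∞`, its value is `ζ`. -/
noncomputable def herglotzSymbol (ζ s : ℂ) : ℂ :=
  (s + (1 + Complex.I * s) * ζ) / (1 - (ζ - Complex.I) * s)

/-- The circle `{1 / (t - i) | t ∈ ℝ ∪ {∞}}`, as the set of `s` with `s - conj s = 2 i |s|²`. -/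
def resolventCircle : Set ℂ := {s | s - conj s = 2 * Complex.I * (s * conj s)}

theorem herglotzSymbol_sub_div {ζ w s : ℂ} (hs : s ∈ resolventCircle)
    (hζ : 1 - (ζ - Complex.I) * s ≠ 0) (hw : 1 - (conj w - Complex.I) * s ≠ 0) (h : ζ ≠ conj w) :
    (herglotzSymbol ζ s - herglotzSymbol (conj w) s) / (ζ - conj w)
      = star (phiSymbol w s) * phiSymbol ζ s := by
  have hs' : s - conj s = 2 * Complex.I * (s * conj s) := hs
  have h1 : (1 - 2 * Complex.I * conj s) * (1 + 2 * Complex.I * s) = 1 := by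
    linear_combination (2 * Complex.I) * hs'
  have h2 : (1 + 2 * Complex.I * s) ≠ 0 := right_ne_zero_of_mul_eq_one h1
  have h3 : (1 - (conj w + Complex.I) * conj s) * (1 + 2 * Complex.I * s)
      = 1 - (conj w - Complex.I) * s := by
    linear_combination (conj w + Complex.I) * hs'
  have h4 : star (phiSymbol w s) = (1 + 2 * Complex.I * s) / (1 - (conj w - Complex.I) * s) := by
    have e : star (phiSymbol w s) = (1 - (conj w + Complex.I) * conj s)⁻¹ := by
      simp [phiSymbol, sub_eq_add_neg]
    rw [e, ← h3]
    rw [← h3] at hw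
    have := left_ne_zero_of_mul hw
    rw [eq_div_iff hw, ← mul_assoc, inv_mul_cancel₀ this, one_mul]
  rw [h4, phiSymbol, herglotzSymbol, herglotzSymbol, div_sub_div _ _ hζ hw, div_div,
    ← div_eq_mul_inv, div_div,
    div_eq_div_iff (mul_ne_zero (mul_ne_zero hζ hw) (sub_ne_zero.2 h)) (mul_ne_zero hw hζ)]
  linear_combination ((1 - (conj w - Complex.I) * s) * (1 - (ζ - Complex.I) * s)
    * (ζ - conj w) * s ^ 2) * Complex.I_sq

theorem ofReal_inv_re_eq {s : ℂ} (hs : s ∈ resolventCircle) (h0 : s ≠ 0) :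
    ((s⁻¹.re : ℝ) : ℂ) = Complex.I + s⁻¹ := by
  have hs' : s - conj s = 2 * Complex.I * (s * conj s) := hs
  have h1 : conj s ≠ 0 := by simpa using h0
  have h2 : conj s⁻¹ = 2 * Complex.I + s⁻¹ := by
    rw [map_inv₀]
    field_simp
    linear_combination hs'
  rw [Complex.re_eq_add_conj, h2]
  ring

theorem herglotzKernel_inv_re {s : ℂ} (hs : s ∈ resolventCircle) (h0 : s ≠ 0) (ζ : ℂ) :
    herglotzKernel ζ s⁻¹.re = herglotzSymbol ζ s := by
  have h1 : 1 + (Complex.I + s⁻¹) * ζ = (s + (1 + Complex.I * s) * ζ) / s := by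
    field_simp
    ring
  have h2 : Complex.I + s⁻¹ - ζ = (1 - (ζ - Complex.I) * s) / s := by
    field_simp
    ring
  rw [herglotzKernel, ofReal_inv_re_eq hs h0, h1, h2, div_div_div_cancel_right₀ h0, herglotzSymbol]

namespace LinRel

/-- By the resolvent identity, `φ_x(ζ) = (1 - (ζ - i) (A - i)⁻¹)⁻¹ x`. -/
theorem phi_mul_one_sub {H : Type*} [NormedAddCommGroup H] [InnerProductSpace ℂ H]
    {A : LinRel H} {ζ : ℂ} (hζ : ζ ∈ A.resolventSet)
    (hI : Complex.I ∈ A.resolventSet) :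
    (1 + (ζ - Complex.I) • A.resolventOp ζ) * (1 - (ζ - Complex.I) • A.resolventOp Complex.I)
      = 1 := by
  have h := resolventOp_sub hζ hI
  have h' : A.resolventOp ζ = A.resolventOp Complex.I
      + (ζ - Complex.I) • (A.resolventOp ζ * A.resolventOp Complex.I) := by
    rw [← h]; abel
  rw [mul_sub, mul_one, add_mul, one_mul, smul_mul_smul_comm]
  nth_rewrite 1 [h']
  rw [smul_add, smul_smul]
  abel

variable {H : Type*} [NormedAddCommGroup H] [InnerProductSpace ℂ H] [CompleteSpace H]

theorem IsSelfAdjointRel.I_mem {A : LinRel H} (hA : A.IsSelfAdjointRel) :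
    Complex.I ∈ A.resolventSet :=
  hA.mem_resolventSet (by simp)

theorem IsSelfAdjointRel.isStarNormal {A : LinRel H} (hA : A.IsSelfAdjointRel) :
    IsStarNormal (A.resolventOp Complex.I) := by
  obtain ⟨h1, h2⟩ := hA.resolventOp_conj hA.I_mem
  refine ⟨?_⟩
  rw [← h2]
  exact resolventOp_commute h1 hA.I_mem

/-- The resolvent identity for `i` and `-i`, transferred to the spectrum. -/
theorem IsSelfAdjointRel.spectrum_subset {A : LinRel H} (hA : A.IsSelfAdjointRel) :
    spectrum ℂ (A.resolventOp Complex.I) ⊆ resolventCircle := by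
  have hN := hA.isStarNormal
  obtain ⟨h1, h2⟩ := hA.resolventOp_conj hA.I_mem
  have h3 := resolventOp_sub hA.I_mem h1
  rw [h2, Complex.conj_I, sub_neg_eq_add, ← two_mul] at h3
  set N := A.resolventOp Complex.I
  have e1 : cfc (fun s : ℂ => s - star s) N = N - star N := by
    rw [cfc_sub (fun s : ℂ => s) (fun s => star s) N, cfc_id' ℂ N, cfc_star_id N]
  have e2 : cfc (fun s : ℂ => 2 * Complex.I * (s * star s)) N
      = (2 * Complex.I) • (N * star N) := by
    rw [cfc_const_mul (2 * Complex.I) (fun s : ℂ => s * star s) N,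
      cfc_mul (fun s : ℂ => s) (fun s => star s) N, cfc_id' ℂ N, cfc_star_id N]
  exact eqOn_of_cfc_eq_cfc (e1.trans (h3.trans e2.symm))

theorem IsSelfAdjointRel.cfc_one_sub {A : LinRel H} (hA : A.IsSelfAdjointRel) (ζ : ℂ) :
    cfc (fun s : ℂ => 1 - (ζ - Complex.I) * s) (A.resolventOp Complex.I)
      = 1 - (ζ - Complex.I) • A.resolventOp Complex.I := by
  have hN := hA.isStarNormal
  rw [cfc_sub (fun _ : ℂ => 1) (fun s => (ζ - Complex.I) * s) _, cfc_const_one ℂ _,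
    cfc_const_mul_id _ _]

/-- `phiSymbol ζ` and `herglotzSymbol ζ` have no pole on the spectrum when `ζ` is in the resolvent
set. This is what covers real `ζ`. -/
theorem IsSelfAdjointRel.one_sub_ne_zero {A : LinRel H} (hA : A.IsSelfAdjointRel) {ζ : ℂ}
    (hζ : ζ ∈ A.resolventSet) {s : ℂ} (hs : s ∈ spectrum ℂ (A.resolventOp Complex.I)) :
    1 - (ζ - Complex.I) * s ≠ 0 := by
  have hN := hA.isStarNormal
  refine (isUnit_cfc_iff (fun s : ℂ => 1 - (ζ - Complex.I) * s) _).1 ?_ s hs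
  rw [hA.cfc_one_sub]
  have h1 := phi_mul_one_sub hζ hA.I_mem
  have hcomm : Commute (1 + (ζ - Complex.I) • A.resolventOp ζ)
      (1 - (ζ - Complex.I) • A.resolventOp Complex.I) :=
    ((Commute.one_left _).add_left (((Commute.one_right _).sub_right
      ((resolventOp_commute hζ hA.I_mem).smul_right _)).smul_left _))
  exact ⟨⟨_, _, hcomm.eq ▸ h1, h1⟩, rfl⟩

theorem IsSelfAdjointRel.continuousOn_phiSymbol {A : LinRel H} (hA : A.IsSelfAdjointRel) {ζ : ℂ}
    (hζ : ζ ∈ A.resolventSet) :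
    ContinuousOn (phiSymbol ζ) (spectrum ℂ (A.resolventOp Complex.I)) :=
  ContinuousOn.inv₀ (by fun_prop) fun _ hs => hA.one_sub_ne_zero hζ hs

theorem IsSelfAdjointRel.continuousOn_herglotzSymbol {A : LinRel H} (hA : A.IsSelfAdjointRel)
    {ζ : ℂ} (hζ : ζ ∈ A.resolventSet) :
    ContinuousOn (herglotzSymbol ζ) (spectrum ℂ (A.resolventOp Complex.I)) :=
  ContinuousOn.div (by fun_prop) (by fun_prop) fun _ hs => hA.one_sub_ne_zero hζ hs

theorem IsSelfAdjointRel.phiField_eq {A : LinRel H} (hA : A.IsSelfAdjointRel) {ζ : ℂ}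
    (hζ : ζ ∈ A.resolventSet) (v : H) :
    A.phiField v ζ = cfc (phiSymbol ζ) (A.resolventOp Complex.I) v := by
  have hN := hA.isStarNormal
  have h1 : cfc (fun s : ℂ => 1 - (ζ - Complex.I) * s) (A.resolventOp Complex.I)
      * cfc (phiSymbol ζ) (A.resolventOp Complex.I) = 1 := by
    rw [← cfc_mul _ _ _ (by fun_prop) (hA.continuousOn_phiSymbol hζ), ← cfc_const_one ℂ
      (A.resolventOp Complex.I)]
    exact cfc_congr fun s hs => mul_inv_cancel₀ (hA.one_sub_ne_zero hζ hs)
  rw [hA.cfc_one_sub] at h1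
  rw [← left_inv_eq_right_inv (phi_mul_one_sub hζ hA.I_mem) h1]
  rfl

/-- The identity `herglotzSymbol_sub_div` between functions on the spectrum, in the functional
calculus of `(A - i)⁻¹`. -/
theorem IsSelfAdjointRel.isQFunction {A : LinRel H} (hA : A.IsSelfAdjointRel) (φ v : H) :
    A.IsQFunction φ v fun ζ => inner ℂ φ (cfc (herglotzSymbol ζ) (A.resolventOp Complex.I) v) := by
  intro ζ hζ w hw hne
  have hN := hA.isStarNormal
  have hw' := (hA.resolventOp_conj hw).1
  set N := A.resolventOp Complex.I with hNdef
  have c1 := hA.continuousOn_phiSymbol hζ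
  have c2 := hA.continuousOn_phiSymbol hw
  have c3 := hA.continuousOn_herglotzSymbol hζ
  have c4 := hA.continuousOn_herglotzSymbol hw'
  rw [← hNdef] at c1 c2 c3 c4
  have e : (ζ - conj w)⁻¹ • (cfc (herglotzSymbol ζ) N - cfc (herglotzSymbol (conj w)) N)
      = star (cfc (phiSymbol w) N) * cfc (phiSymbol ζ) N := by
    rw [← cfc_sub _ _ _ c3 c4,
      ← cfc_smul _ (fun s => herglotzSymbol ζ s - herglotzSymbol (conj w) s) _
      (c3.sub c4), ← cfc_star,
      ← cfc_mul (fun s => star (phiSymbol w s)) _ _ (continuous_star.comp_continuousOn c2) c1]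
    refine cfc_congr fun s hs => ?_
    rw [← herglotzSymbol_sub_div (hA.spectrum_subset hs) (hA.one_sub_ne_zero hζ hs)
      (hA.one_sub_ne_zero hw' hs) hne, smul_eq_mul, div_eq_inv_mul]
  rw [hA.phiField_eq hζ, hA.phiField_eq hw, ← ContinuousLinearMap.adjoint_inner_right,
    ← ContinuousLinearMap.star_eq_adjoint, ← mul_apply_eq_comp, ← hNdef, ← e, smul_apply, sub_apply,
    inner_smul_right, inner_sub_right, div_eq_inv_mul]

end LinRel

/-! ### From spectral measures to measures on the real line -/

theorem measurable_herglotzKernel (ζ : ℂ) : Measurable (herglotzKernel ζ) := by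
  unfold herglotzKernel
  fun_prop

/-- The image on the real line, under `s ↦ t = i + 1 / s`, of a measure on the circle
`resolventCircle`; the mass of `s = 0`, that is of `t = ∞`, is left out. The map is written
`s ↦ Re (1 / s)`, with which it agrees on the circle. -/
noncomputable def realLineMeasure (μ : Measure ℂ) : Measure ℝ :=
  (μ.restrict {0}ᶜ).map fun s => s⁻¹.re

instance (μ : Measure ℂ) [IsFiniteMeasure μ] : IsFiniteMeasure (realLineMeasure μ) :=
  Measure.isFiniteMeasure_map _ _

theorem ae_herglotzKernel_eq {μ : Measure ℂ} (hμ : ∀ᵐ s ∂μ, s ∈ resolventCircle) (ζ : ℂ) :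
    (herglotzKernel ζ ∘ fun s : ℂ => s⁻¹.re) =ᵐ[μ.restrict {0}ᶜ] herglotzSymbol ζ := by
  filter_upwards [ae_restrict_of_ae hμ, ae_restrict_mem (measurableSet_singleton 0).compl]
    with s hs h0
  exact herglotzKernel_inv_re hs h0 ζ

theorem integrable_realLineMeasure {μ : Measure ℂ} (hμ : ∀ᵐ s ∂μ, s ∈ resolventCircle) {ζ : ℂ}
    (hint : Integrable (herglotzSymbol ζ) μ) :
    Integrable (herglotzKernel ζ) (realLineMeasure μ) := by
  rw [realLineMeasure, integrable_map_measure (measurable_herglotzKernel ζ).aestronglyMeasurable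
    (by fun_prop)]
  exact hint.restrict.congr (ae_herglotzKernel_eq hμ ζ).symm

theorem integral_herglotzSymbol {μ : Measure ℂ} (hμ : ∀ᵐ s ∂μ, s ∈ resolventCircle) {ζ : ℂ}
    (hint : Integrable (herglotzSymbol ζ) μ) :
    ∫ s, herglotzSymbol ζ s ∂μ
      = μ.real {0} * ζ + ∫ t, herglotzKernel ζ t ∂(realLineMeasure μ) := by
  have h1 : ∫ t, herglotzKernel ζ t ∂(realLineMeasure μ)
      = ∫ s in {0}ᶜ, herglotzSymbol ζ s ∂μ := by
    rw [realLineMeasure, integral_map (by fun_prop)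
      (measurable_herglotzKernel ζ).aestronglyMeasurable]
    exact integral_congr_ae (ae_herglotzKernel_eq hμ ζ)
  have h2 : ∫ s in {0}, herglotzSymbol ζ s ∂μ = μ.real {0} * ζ := by
    rw [integral_singleton]
    simp [herglotzSymbol]
  rw [h1, ← h2, integral_add_compl (measurableSet_singleton 0) hint]

section

variable {H : Type*} [NormedAddCommGroup H] [InnerProductSpace ℂ H]

/-- Polarization. -/
theorem inner_apply_polarization (T : H →L[ℂ] H) (x y : H) :
    inner ℂ y (T x) = ∑ k : Fin 4, Complex.I ^ (k : ℕ) *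
      inner ℂ ((1 / 2 : ℂ) • (x + Complex.I ^ (k : ℕ) • y))
        (T ((1 / 2 : ℂ) • (x + Complex.I ^ (k : ℕ) • y))) := by
  rw [Fin.sum_univ_four]
  simp only [map_smul, map_add, inner_smul_left, inner_smul_right, inner_add_left,
    inner_add_right, Fin.val_zero, Fin.val_one, Fin.val_two, pow_zero, pow_one, map_pow,
    map_one, Complex.conj_I, map_div₀, map_ofNat]
  rw [show ((3 : Fin 4) : ℕ) = 3 from rfl]
  have h3 : Complex.I ^ 3 = -Complex.I := Complex.I_pow_three
  have h2 : Complex.I ^ 2 = -1 := Complex.I_sq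
  have h3' : (-Complex.I) ^ 3 = Complex.I := by rw [Odd.neg_pow (by decide), h3, neg_neg]
  simp only [h3', neg_sq, h3, h2]
  ring_nf
  simp only [h2]
  ring

/-- The `Q`-function of `IsSelfAdjointRel.isQFunction` in terms of positive measures on the line and
their masses `a k` at infinity. -/
theorem LinRel.IsSelfAdjointRel.exists_herglotz_data [CompleteSpace H] {A : LinRel H}
    (hA : A.IsSelfAdjointRel) (φ v : H) :
    ∃ (P : Fin 4 → Measure ℝ) (_ : ∀ k, IsFiniteMeasure (P k)) (a : Fin 4 → ℝ),
      (∀ k, 0 ≤ a k) ∧ ∀ ζ ∈ A.resolventSet, (∀ k, Integrable (herglotzKernel ζ) (P k)) ∧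
        inner ℂ φ (cfc (herglotzSymbol ζ) (A.resolventOp Complex.I) v)
          = ∑ k : Fin 4, Complex.I ^ (k : ℕ) * (a k * ζ + ∫ t, herglotzKernel ζ t ∂(P k)) := by
  choose μ hfin hsupp hμ using fun x => exists_spectralMeasure hA.isStarNormal x
  have hcirc : ∀ x, ∀ᵐ s ∂(μ x), s ∈ resolventCircle := fun x =>
    (hsupp x).mono fun s hs => hA.spectrum_subset hs
  let u : Fin 4 → H := fun k => (1 / 2 : ℂ) • (v + Complex.I ^ (k : ℕ) • φ)
  refine ⟨fun k => realLineMeasure (μ (u k)), fun k => inferInstance, fun k => (μ (u k)).real {0},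
    fun k => measureReal_nonneg, fun ζ hζ => ?_⟩
  have hc := fun x => hμ x (herglotzSymbol ζ) (hA.continuousOn_herglotzSymbol hζ)
  refine ⟨fun k => integrable_realLineMeasure (hcirc _) (hc _).1, ?_⟩
  rw [inner_apply_polarization]
  refine Finset.sum_congr rfl fun k _ => ?_
  rw [(hc (u k)).2, integral_herglotzSymbol (hcirc _) (hc _).1]

end

/-! ### Herglotz-Nevanlinna functions -/

theorem hasDerivAt_herglotzKernel {ζ : ℂ} (hζ : ζ.im ≠ 0) (t : ℝ) :
    HasDerivAt (fun z => herglotzKernel z t) ((1 + (t : ℂ) ^ 2) / ((t : ℂ) - ζ) ^ 2) ζ := by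
  have h0 := ofReal_sub_ne_zero hζ t
  have h1 : HasDerivAt (fun z : ℂ => 1 + (t : ℂ) * z) (t : ℂ) ζ := by
    simpa using ((hasDerivAt_id ζ).const_mul (t : ℂ)).const_add 1
  have h2 : HasDerivAt (fun z : ℂ => (t : ℂ) - z) (-1) ζ := by
    simpa using (hasDerivAt_id ζ).const_sub (t : ℂ)
  have h3 : HasDerivAt (fun z => herglotzKernel z t) _ ζ := h1.div h2 h0
  refine h3.congr_deriv ?_
  congr 1
  ring

theorem herglotzKernel_conj (ζ : ℂ) (t : ℝ) :
    herglotzKernel (conj ζ) t = conj (herglotzKernel ζ t) := by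
  simp [herglotzKernel]

theorem herglotzKernel_im_nonneg {ζ : ℂ} (hζ : 0 < ζ.im) (t : ℝ) :
    0 ≤ (herglotzKernel ζ t).im := by
  rw [herglotzKernel, Complex.div_im, ← sub_div]
  refine div_nonneg ?_ (Complex.normSq_nonneg _)
  simp
  nlinarith [mul_nonneg hζ.le (sq_nonneg t)]

/-- The derivative is `r² + (1 + ζ r)²` with `r = (t - ζ)⁻¹`, because `t r = 1 + ζ r`. -/
theorem norm_deriv_herglotzKernel_le {ζ : ℂ} (hζ : ζ.im ≠ 0) (t : ℝ) :
    ‖(1 + (t : ℂ) ^ 2) / ((t : ℂ) - ζ) ^ 2‖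
      ≤ |ζ.im|⁻¹ ^ 2 + (1 + ‖ζ‖ * |ζ.im|⁻¹) ^ 2 := by
  have h0 := ofReal_sub_ne_zero hζ t
  have e : (1 + (t : ℂ) ^ 2) / ((t : ℂ) - ζ) ^ 2
      = ((t : ℂ) - ζ)⁻¹ ^ 2 + (1 + ζ * ((t : ℂ) - ζ)⁻¹) ^ 2 := by
    field_simp
    ring
  have hr := norm_inv_ofReal_sub_le hζ t
  rw [e]
  refine (norm_add_le _ _).trans ?_
  rw [norm_pow, norm_pow]
  have h3 : ‖1 + ζ * ((t : ℂ) - ζ)⁻¹‖ ≤ 1 + ‖ζ‖ * |ζ.im|⁻¹ := by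
    refine (norm_add_le _ _).trans ?_
    rw [norm_one, norm_mul]
    gcongr
  gcongr

theorem differentiableAt_integral_herglotzKernel (P : Measure ℝ) [IsFiniteMeasure P] {ζ : ℂ}
    (hζ : ζ.im ≠ 0) : DifferentiableAt ℂ (fun z => ∫ t, herglotzKernel z t ∂P) ζ := by
  -- On the ball of radius `|Im ζ| / 2` the derivative of the kernel is uniformly bounded.
  set r := |ζ.im| / 2 with hr
  have hpos : 0 < |ζ.im| := abs_pos.2 hζ
  have hball : ∀ z ∈ Metric.ball ζ r, r ≤ |z.im| := by
    intro z hz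
    have h1 : |(z - ζ).im| < r :=
      (Complex.abs_im_le_norm _).trans_lt (by simpa [dist_eq_norm] using hz)
    have h2 : |ζ.im| ≤ |z.im| + |(z - ζ).im| := by
      have := abs_sub_abs_le_abs_sub ζ.im z.im
      rw [Complex.sub_im, abs_sub_comm z.im]
      linarith
    rw [hr] at h1 ⊢
    linarith
  have hrpos : 0 < r := by positivity
  have hne : ∀ z ∈ Metric.ball ζ r, z.im ≠ 0 := fun z hz => abs_pos.1 (hrpos.trans_le (hball z hz))
  refine (hasDerivAt_integral_of_dominated_loc_of_deriv_le (Metric.ball_mem_nhds ζ hrpos)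
    (bound := fun _ => r⁻¹ ^ 2 + (1 + (‖ζ‖ + r) * r⁻¹) ^ 2)
    (μ := P) (F := fun z t => herglotzKernel z t)
    (F' := fun z (t : ℝ) => (1 + (t : ℂ) ^ 2) / ((t : ℂ) - z) ^ 2)
    ?_ ?_ ?_ ?_ ?_ ?_).2.differentiableAt
  · exact Filter.Eventually.of_forall fun z => (measurable_herglotzKernel z).aestronglyMeasurable
  · exact integrable_herglotzKernel P hζ
  · exact Measurable.aestronglyMeasurable (by fun_prop)
  · refine Filter.Eventually.of_forall fun t z hz => ?_
    refine (norm_deriv_herglotzKernel_le (hne z hz) t).trans ?_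
    have h1 : |z.im|⁻¹ ≤ r⁻¹ := inv_anti₀ hrpos (hball z hz)
    have h2 : ‖z‖ ≤ ‖ζ‖ + r := by
      have : ‖z - ζ‖ < r := by simpa [dist_eq_norm] using hz
      have h3 := norm_add_le ζ (z - ζ)
      rw [add_sub_cancel] at h3
      linarith
    gcongr
  · exact integrable_const _
  · exact Filter.Eventually.of_forall fun t z hz => hasDerivAt_herglotzKernel (hne z hz) t

/-- The sufficiency part of the Herglotz-Nevanlinna representation theorem. -/
theorem isHerglotzNevanlinna_integral (P : Measure ℝ) [IsFiniteMeasure P] (c a : ℝ) (ha : 0 ≤ a) :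
    IsHerglotzNevanlinna fun ζ => (c : ℂ) + a * ζ + ∫ t, herglotzKernel ζ t ∂P := by
  have hopen : IsOpen {ζ : ℂ | ζ.im ≠ 0} := isOpen_ne_fun Complex.continuous_im continuous_const
  refine ⟨?_, fun ζ _ => ?_, fun ζ hζ => ?_⟩
  · refine DifferentiableOn.analyticOnNhd (fun ζ hζ => ?_) hopen
    exact (DifferentiableAt.add (by fun_prop)
      (differentiableAt_integral_herglotzKernel P hζ)).differentiableWithinAt
  · simp only [herglotzKernel_conj, map_add, map_mul, Complex.conj_ofReal, ← integral_conj]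
  · have h1 : (∫ t, herglotzKernel ζ t ∂P).im = ∫ t, (herglotzKernel ζ t).im ∂P :=
      (integral_im (𝕜 := ℂ) (integrable_herglotzKernel P hζ.ne')).symm
    have h2 : 0 ≤ ∫ t, (herglotzKernel ζ t).im ∂P :=
      integral_nonneg fun t => herglotzKernel_im_nonneg hζ t
    simp only [Complex.add_im, Complex.ofReal_im, Complex.im_ofReal_mul, h1, zero_add]
    positivity

theorem IsHerglotzNevanlinna.isQuasiHerglotz {q h₁ h₂ h₃ h₄ : ℂ → ℂ}
    (H₁ : IsHerglotzNevanlinna h₁) (H₂ : IsHerglotzNevanlinna h₂) (H₃ : IsHerglotzNevanlinna h₃)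
    (H₄ : IsHerglotzNevanlinna h₄)
    (hq : ∀ ζ : ℂ, ζ.im ≠ 0 → q ζ = (h₁ ζ - h₂ ζ) + Complex.I * (h₃ ζ - h₄ ζ)) :
    IsQuasiHerglotz q := by
  refine ⟨?_, h₁, h₂, h₃, h₄, H₁, H₂, H₃, H₄, hq⟩
  have hopen : IsOpen {ζ : ℂ | ζ.im ≠ 0} := isOpen_ne_fun Complex.continuous_im continuous_const
  have h : AnalyticOnNhd ℂ (fun ζ => (h₁ ζ - h₂ ζ) + Complex.I * (h₃ ζ - h₄ ζ))
      {ζ | ζ.im ≠ 0} :=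
    (H₁.1.sub H₂.1).add (analyticOnNhd_const.mul (H₃.1.sub H₄.1))
  exact h.congr hopen fun ζ hζ => (hq ζ hζ).symm

/-! ### Q-functions -/

namespace LinRel

variable {H : Type*} [NormedAddCommGroup H] [InnerProductSpace ℂ H] [CompleteSpace H]

/-- The defining identity fixes a `Q`-function up to an additive constant. -/
theorem IsSelfAdjointRel.isQFunction_iff {A : LinRel H} (hA : A.IsSelfAdjointRel) {φ v : H}
    {q₀ : ℂ → ℂ} (h₀ : A.IsQFunction φ v q₀) (q : ℂ → ℂ) :
    A.IsQFunction φ v q ↔ ∃ c : ℂ, ∀ ζ ∈ A.resolventSet, q ζ = c + q₀ ζ := by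
  constructor
  · intro h
    refine ⟨q Complex.I - q₀ Complex.I, fun ζ hζ => ?_⟩
    by_cases hne : ζ = Complex.I
    · subst hne
      ring
    -- Compare the two quotients at `w = -i`, for which `conj w = i`.
    · have hne' : ζ ≠ conj (-Complex.I) := by simpa using hne
      have hI : -Complex.I ∈ A.resolventSet := hA.mem_resolventSet (by simp)
      have h1 := (h ζ hζ _ hI hne').trans (h₀ ζ hζ _ hI hne').symm
      rw [div_left_inj' (sub_ne_zero.2 hne'), map_neg, Complex.conj_I, neg_neg] at h1
      linear_combination h1
  · rintro ⟨c, hc⟩ ζ hζ w hw hne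
    rw [hc ζ hζ, hc _ (hA.resolventOp_conj hw).1, add_sub_add_left_eq_sub]
    exact h₀ ζ hζ w hw hne

end LinRel

theorem mainTheorem2 {H : Type*} [NormedAddCommGroup H] [InnerProductSpace ℂ H] [CompleteSpace H]
    (S A : LinRel H) (hS : S.IsSymmetricRel) (hS_index : S.HasDeficiencyIndexOne)
    (hA : A.IsSelfAdjointRel) (hSA : S ≤ A)
    (φ : H) (hφ : φ ∈ S.defect Complex.I) (hφ_ne : φ ≠ 0) (v : H) :
    (∃ (b : ℂ) (ν : ComplexMeasure ℝ),
      (∀ ζ ∈ A.resolventSet, ν.Integrable (herglotzKernel ζ)) ∧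
      (∀ q : ℂ → ℂ, A.IsQFunction φ v q ↔
        ∃ c : ℂ, ∀ ζ ∈ A.resolventSet, q ζ = quasiHerglotzFormula c b ν ζ) ∧
      (∀ q : ℂ → ℂ, A.IsQFunction φ v q → ∀ (c' b' : ℂ) (ν' : ComplexMeasure ℝ),
        (∀ ζ : ℂ, ζ.im ≠ 0 → q ζ = quasiHerglotzFormula c' b' ν' ζ) → b' = b ∧ ν' = ν)) ∧
    (∀ q : ℂ → ℂ, A.IsQFunction φ v q → IsQuasiHerglotz q) := by
  obtain ⟨P, hP, a, ha, hPa⟩ := hA.exists_herglotz_data φ v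
  have hq := hA.isQFunction_iff (hA.isQFunction φ v)
  have hformula : ∀ (c : ℂ), ∀ ζ ∈ A.resolventSet,
      c + inner ℂ φ (cfc (herglotzSymbol ζ) (A.resolventOp Complex.I) v)
        = quasiHerglotzFormula c (∑ k : Fin 4, Complex.I ^ (k : ℕ) * a k)
          (complexOfMeasures P) ζ := by
    intro c ζ hζ
    rw [quasiHerglotzFormula, integral_complexOfMeasures (hPa ζ hζ).1, (hPa ζ hζ).2,
      Finset.sum_mul, add_assoc, ← Finset.sum_add_distrib]
    congr 1
    exact Finset.sum_congr rfl fun k _ => by ring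
  have hiff : ∀ q : ℂ → ℂ, A.IsQFunction φ v q ↔ ∃ c : ℂ, ∀ ζ ∈ A.resolventSet,
      q ζ = quasiHerglotzFormula c (∑ k : Fin 4, Complex.I ^ (k : ℕ) * a k)
        (complexOfMeasures P) ζ := fun q => by
    rw [hq]
    exact exists_congr fun c => forall₂_congr fun ζ hζ => by rw [hformula c ζ hζ]
  refine ⟨⟨∑ k : Fin 4, Complex.I ^ (k : ℕ) * a k, complexOfMeasures P,
    fun ζ hζ => integrable_complexOfMeasures (hPa ζ hζ).1, hiff, ?_⟩, ?_⟩
  · intro q hqQ c' b' ν' h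
    obtain ⟨c, hc⟩ := (hiff q).1 hqQ
    exact quasiHerglotzFormula_unique fun ζ hζ =>
      (h ζ hζ).symm.trans (hc ζ (hA.mem_resolventSet hζ))
  · intro q hqQ
    obtain ⟨c, hc⟩ := (hq q).1 hqQ
    refine IsHerglotzNevanlinna.isQuasiHerglotz
      (isHerglotzNevanlinna_integral (P 0) c.re (a 0) (ha 0))
      (isHerglotzNevanlinna_integral (P 2) 0 (a 2) (ha 2))
      (isHerglotzNevanlinna_integral (P 1) c.im (a 1) (ha 1))
      (isHerglotzNevanlinna_integral (P 3) 0 (a 3) (ha 3)) fun ζ hζ => ?_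
    have hζ' := hA.mem_resolventSet hζ
    rw [hc ζ hζ', (hPa ζ hζ').2, Fin.sum_univ_four]
    norm_num [pow_succ]
    linear_combination -(Complex.re_add_im c)
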